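/- Let $S$ be a monoid with zero. Let $\mathcal{F}ac\,S$ be the category whose objects are the elements of $S\setminus 0$ and whose morphisms $a\to b$ are the pairs $(\alpha,\beta)\in S\times S$ with $\alpha a\beta=b$, with composition $(\alpha',\beta')(\alpha,\beta)=(\alpha'\alpha,\beta\beta')$. Let $\mathcal{N}at\,S$ be the abelian category of natural systems on $S$, i.e. of functors $\mathbf D:\mathcal{F}ac\,S\to\mathcal{A}b$; write $\mathbf D_a$ for the value at $a$, $\alpha_*=\mathbf D(\alpha,1)$ and $\beta^*=\mathbf D(1,\beta)$. Let $\mathbf Z$ be the trivial natural system: each $\mathbf Z_a$ is infinite cyclic with generator $[a]$, and every morphism $a\to b$ sends $[a]$ to $[b]$. For $n\ge 0$ let $C^n(S,\mathbf D)$ be the group of functions assigning to each $n$-tuple $(a_1,\dots,a_n)$ in $S$ with $a_1\cdots a_n\neq 0$ an element of $\mathbf D_{a_1\cdots a_n}$ (the empty tuple has product $1$, so $C^0(S,\mathbf D)=\mathbf D_1$ if $1\ne 0$), with the coboundary $$(\Delta^n f)(a_1,\dots,a_{n+1})=a_{1*}f(a_2,\dots,a_{n+1})+\sum_{i=1}^n(-1)^i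 f(a_1,\dots,a_ia_{i+1},\dots,a_{n+1})+(-1)^{n+1}a_{n+1}^*f(a_1,\dots,a_n),$$ and let $H^n(S,\mathbf D)$ be the $n$-th cohomology group of this complex. Then: 1. For every $n\ge 0$ there is an isomorphism, natural in $\mathbf D\in\mathcal{N}at\,S$, $$H^n(S,\mathbf D)\cong\mathrm{Ext}^n_{\mathcal{N}at\,S}(\mathbf Z,\mathbf D).$$ 2. For $n\ge 0$ let $\mathbf B_n$ be the natural system whose value at $a$ is the free abelian group on the symbols $[a_0,\dots,a_{n+1}]$ with $a_i\in S$ and $a_0\cdots a_{n+1}=a$, with $\mathbf B_n(\alpha,\beta)[a_0,\dots,a_{n+1}]=[\alpha a_0,a_1,\dots,a_n,a_{n+1}\beta]$, and for $n\ge 1$ let $\partial_n:\mathbf B_n\to\mathbf B_{n-1}$ be given by $\partial_n[a_0,\dots,a_{n+1}]=\sum_{i=0}^n(-1)^i[a_0,\dots,a_ia_{i+1},\dots,a_{n+1}]$. Then the $\mathbf B_n$ are projective objects of $\mathcal{N}at\,S$, and $(\mathbf B_n,\partial_n)_{n\ge0}$, with the augmentation $\mathbf B_0\to\mathbf Z$,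 $[a_0,a_1]\mapsto[a_0a_1]$, is a projective resolution of $\mathbf Z$. 3. Let a (unital) 0-module over $S$ be an abelian group $A$ with an action $(S\setminus0)\times A\to A$ such that $s(a+b)=sa+sb$, $s(ta)=(st)a$ whenever $st\ne0$, and $1a=a$ if $1\neq 0$; morphisms are the equivariant homomorphisms. Let $H_0^n(S,A)$ be the $n$-th cohomology group of the complex of functions $f$ assigning an element of $A$ to each $n$-tuple in $S$ with nonzero product, with the coboundary $x_1f(x_2,\dots,x_{n+1})+\sum_{i=1}^n(-1)^if(x_1,\dots,x_ix_{i+1},\dots,x_{n+1})+(-1)^{n+1}f(x_1,\dots,x_n)$. Let $\mathbf A$ be the natural system with $\mathbf A_s=A$ for all $s$ and $\mathbf A(\alpha,\beta)a=\alpha a$. Then for every $n\ge0$ there is an isomorphism, natural in $A$, $$H_0^n(S,A)\cong\mathrm{Ext}^n_{\mathcal{N}at\,S}(\mathbf Z,\mathbf A).$$ -/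

import Mathlib

open CategoryTheory

universe u

noncomputable section

namespace FacCohomology

/-! ### The category of factorizations and natural systems -/

/-- The objects of the category of factorizations in `S`: the nonzero elements of `S`. -/
structure Fac (S : Type u) [MonoidWithZero S] : Type u where
  val : S
  ne_zero : val ≠ 0

/-- A morphism `a ⟶ b` of factorizations: a pair `(left, right)` with `left * a * right = b`. -/
@[ext]
structure FacHom {S : Type u} [MonoidWithZero S] (a b : Fac S) : Type u where
  left : S
  right : S
  fac : left * a.val * right = b.val

instance (S : Type u) [MonoidWithZero S] : Category.{u} (Fac S) where
  Hom a b := FacHom a b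
  id a := ⟨1, 1, by simp⟩
  comp f g := ⟨g.left * f.left, f.right * g.right, by
    rw [← g.fac, ← f.fac]; simp only [mul_assoc]⟩
  id_comp f := by apply FacHom.ext <;> simp
  comp_id f := by apply FacHom.ext <;> simp
  assoc f g h := by apply FacHom.ext <;> simp [mul_assoc]

/-- The category of natural systems on `S`: functors from the category of factorizations to
abelian groups. -/
abbrev NatSys (S : Type u) [MonoidWithZero S] : Type (u + 1) := Fac S ⥤ AddCommGrpCat.{u}

/-- Functors from a small category to abelian groups form a Grothendieck abelian category.  In
particular there are enough injectives and the groups `Ext` are defined. -/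
instance (S : Type u) [MonoidWithZero S] : IsGrothendieckAbelian.{u} (NatSys S) where
  ab5OfSize := ⟨fun _ _ _ => inferInstance⟩
  hasSeparator :=
    HasSeparator.of_equivalence (C := ((Fac S)ᵒᵖ)ᵒᵖ ⥤ AddCommGrpCat.{u})
      ((opOpEquivalence (Fac S)).congrLeft)

/-- The trivial natural system: every value is infinite cyclic, generated by `ULift.up 1`, and
every morphism sends the generator to the generator. -/
def trivialSystem (S : Type u) [MonoidWithZero S] : NatSys S :=
  (Functor.const (Fac S)).obj (AddCommGrpCat.of (ULift.{u} ℤ))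

/-! ### Tuples and their products -/

section Tuples

variable {S : Type u}

/-- The product `a₁ ⋯ aₙ` of a tuple (`1` for the empty tuple). -/
def tprod [Monoid S] {n : ℕ} (a : Fin n → S) : S := (List.ofFn a).prod

/-- The tuple `(a₁, …, aᵢ aᵢ₊₁, …, aₙ₊₁)`; here the position `i` is counted from `0`. -/
def contract [Monoid S] {n : ℕ} (a : Fin (n + 1) → S) (i : Fin n) : Fin n → S :=
  Fin.contractNth i.castSucc (· * ·) a

theorem tprod_succ [Monoid S] {n : ℕ} (a : Fin (n + 1) → S) :
    tprod a = a 0 * tprod (Fin.tail a) := by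
  simp [tprod, List.ofFn_succ, Fin.tail_def]

theorem tprod_last [Monoid S] {n : ℕ} (a : Fin (n + 1) → S) :
    tprod a = tprod (Fin.init a) * a (Fin.last n) := by
  rw [tprod, List.ofFn_succ']
  simp [tprod, Fin.init_def]

theorem tprod_contract [Monoid S] {n : ℕ} (a : Fin (n + 1) → S) (i : Fin n) :
    tprod (contract a i) = tprod a := by
  induction n with
  | zero => exact i.elim0
  | succ n ih =>
    rw [tprod_succ, tprod_succ a]
    rcases Fin.eq_zero_or_eq_succ i with rfl | ⟨j, rfl⟩
    · have h1 : contract a 0 0 = a 0 * a 1 := by simp [contract, Fin.contractNth]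
      have h2 : Fin.tail (contract a 0) = Fin.tail (Fin.tail a) := by
        ext k
        simp [contract, Fin.contractNth, Fin.tail]
      rw [h1, h2, tprod_succ (Fin.tail a), mul_assoc]
      rfl
    · have h1 : contract a j.succ 0 = a 0 := by simp [contract, Fin.contractNth]
      have h2 : Fin.tail (contract a j.succ) = contract (Fin.tail a) j := by
        ext k
        simp [contract, Fin.contractNth, Fin.tail]
      rw [h1, h2, ih]

theorem contract_contract [Monoid S] {n : ℕ} (a : Fin (n + 2) → S) (i j : Fin n) (h : i ≤ j) :
    contract (contract a j.succ) i = contract (contract a i.castSucc) j := by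
  ext k
  have h' : (i : ℕ) ≤ j := h
  simp only [contract, Fin.contractNth, Fin.val_castSucc, Fin.val_succ]
  split_ifs <;> first | rfl | omega | simp [mul_assoc]

/-- The tuple `(α a₀, a₁, …, aₙ, aₙ₊₁ β)`. -/
def actTuple [Monoid S] {n : ℕ} (α β : S) (a : Fin (n + 2) → S) : Fin (n + 2) → S :=
  fun i => (if i = 0 then α else 1) * a i * (if i = Fin.last (n + 1) then β else 1)

theorem tprod_actTuple [Monoid S] {n : ℕ} (α β : S) (a : Fin (n + 2) → S) :
    tprod (actTuple α β a) = α * tprod a * β := by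
  rw [tprod_succ, tprod_last (Fin.tail (actTuple α β a)), tprod_succ a, tprod_last (Fin.tail a)]
  have h : Fin.init (Fin.tail (actTuple α β a)) = Fin.init (Fin.tail a) := by
    ext k
    have h1 : k.castSucc.succ ≠ Fin.last (n + 1) := by
      intro h; have := congrArg Fin.val h; simp at this; omega
    simp [actTuple, Fin.init, Fin.tail, h1]
  rw [h]
  simp [actTuple, Fin.tail, mul_assoc]

theorem contract_actTuple [Monoid S] {n : ℕ} (α β : S) (a : Fin (n + 3) → S)
    (i : Fin (n + 2)) : contract (actTuple α β a) i = actTuple α β (contract a i) := by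
  ext k
  simp only [contract, Fin.contractNth, actTuple, Fin.val_castSucc, Fin.ext_iff, Fin.val_succ,
    Fin.val_zero, Fin.val_last]
  split_ifs <;> first | contradiction | omega | simp [mul_assoc]

end Tuples

/-- The cancellation behind `d ∘ d = 0` for alternating sums of faces. -/
theorem alternating_sum_eq_zero {M : Type*} [AddCommGroup M] {n : ℕ}
    (g : Fin (n + 2) → Fin (n + 1) → M)
    (hg : ∀ i j : Fin (n + 1), i ≤ j → g j.succ i = g i.castSucc j) :
    ∑ j : Fin (n + 2), (-1 : ℤ) ^ (j : ℕ) • ∑ i : Fin (n + 1), (-1 : ℤ) ^ (i : ℕ) • g j i = 0 := by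
  simp only [Finset.smul_sum, smul_smul, ← pow_add, ← Finset.sum_product']
  rw [Finset.univ_product_univ]
  let s : Finset (Fin (n + 2) × Fin (n + 1)) := {p | (p.2 : ℕ) < (p.1 : ℕ)}
  rw [← Finset.sum_add_sum_compl s, ← eq_neg_iff_add_eq_zero, ← Finset.sum_neg_distrib]
  refine Finset.sum_bij'
    (fun p _ => (p.2.castSucc, ⟨(p.1 : ℕ) - 1, by have := p.1.isLt; omega⟩))
    (fun p hp => (p.2.succ, ⟨(p.1 : ℕ), by
      have h1 : ¬ (p.2 : ℕ) < (p.1 : ℕ) := by simpa [s] using hp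
      have := p.2.isLt; omega⟩)) ?_ ?_ ?_ ?_ ?_
  · rintro ⟨j, i⟩ h
    simp [s] at h ⊢
    omega
  · rintro ⟨j, i⟩ h
    simp [s] at h ⊢
    omega
  · rintro ⟨j, i⟩ h
    simp [s] at h
    ext <;> simp
    omega
  · rintro ⟨j, i⟩ h
    ext <;> simp
  · rintro ⟨j, i⟩ h
    have h' : (i : ℕ) < (j : ℕ) := by simpa [s] using h
    obtain ⟨j, rfl⟩ := Fin.eq_succ_of_ne_zero (i := j) (by rintro rfl; simp at h')
    have h2 : i ≤ j := by simp at h'; exact Fin.le_def.2 (by omega)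
    simp only [Fin.val_succ, Nat.add_sub_cancel, Fin.eta, Fin.val_castSucc, hg i j h2]
    rw [← neg_smul]
    congr 1
    ring

/-! ### Cohomology of `S` with coefficients in a natural system -/

/-- The nerve of `S` in degree `n`: the `n`-tuples with nonzero product. -/
def Nerve (S : Type u) [MonoidWithZero S] (n : ℕ) : Type u :=
  {a : Fin n → S // tprod a ≠ 0}

section Nerve

variable {S : Type u} [MonoidWithZero S] {n : ℕ}

/-- The product of an element of the nerve, as an object of the category of factorizations. -/
def Nerve.obj (a : Nerve S n) : Fac S := ⟨tprod a.1, a.2⟩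

/-- `(a₂, …, aₙ₊₁)`. -/
def Nerve.tail (a : Nerve S (n + 1)) : Nerve S n :=
  ⟨Fin.tail a.1, fun h => a.2 (by rw [tprod_succ, h, mul_zero])⟩

/-- `(a₁, …, aₙ)`. -/
def Nerve.init (a : Nerve S (n + 1)) : Nerve S n :=
  ⟨Fin.init a.1, fun h => a.2 (by rw [tprod_last, h, zero_mul])⟩

/-- `(a₁, …, aᵢ aᵢ₊₁, …, aₙ₊₁)`; here the position `i` is counted from `0`. -/
def Nerve.contract (a : Nerve S (n + 1)) (i : Fin n) : Nerve S n :=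
  ⟨FacCohomology.contract a.1 i, by rw [tprod_contract]; exact a.2⟩

/-- The morphism `(a₁, 1) : a₂ ⋯ aₙ₊₁ ⟶ a₁ ⋯ aₙ₊₁`. -/
def Nerve.tailHom (a : Nerve S (n + 1)) : a.tail.obj ⟶ a.obj :=
  FacHom.mk (a.1 0) 1 (by simp [Nerve.obj, Nerve.tail, tprod_succ a.1])

/-- The morphism `(1, aₙ₊₁) : a₁ ⋯ aₙ ⟶ a₁ ⋯ aₙ₊₁`. -/
def Nerve.initHom (a : Nerve S (n + 1)) : a.init.obj ⟶ a.obj :=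
  FacHom.mk 1 (a.1 (Fin.last n)) (by simp [Nerve.obj, Nerve.init, tprod_last a.1])

/-- The identity of `a₁ ⋯ aₙ₊₁`, its source being written as the product of the contracted
tuple. -/
def Nerve.contractHom (a : Nerve S (n + 1)) (i : Fin n) : (a.contract i).obj ⟶ a.obj :=
  FacHom.mk 1 1 (by simp [Nerve.obj, Nerve.contract, tprod_contract])

end Nerve

/-- The group of `n`-dimensional cochains: functions assigning to `(a₁, …, aₙ)` in the nerve an
element of the value of `D` at `a₁ ⋯ aₙ`. -/
abbrev Cochain {S : Type u} [MonoidWithZero S] (D : NatSys S) (n : ℕ) : Type u :=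
  ∀ a : Nerve S n, D.obj a.obj

/-- The coboundary homomorphism.  The sum over `1 ≤ i ≤ n` is indexed by `i - 1 : Fin n`. -/
def coboundary {S : Type u} [MonoidWithZero S] (D : NatSys S) (n : ℕ) :
    Cochain D n →+ Cochain D (n + 1) where
  toFun f a :=
    D.map a.tailHom (f a.tail) +
      ∑ i : Fin n, (-1 : ℤ) ^ ((i : ℕ) + 1) • D.map (a.contractHom i) (f (a.contract i)) +
      (-1 : ℤ) ^ (n + 1) • D.map a.initHom (f a.init)
  map_zero' := by
    funext a
    simp
  map_add' f g := by
    funext a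
    simp only [Pi.add_apply, map_add, smul_add, Finset.sum_add_distrib]
    abel

section CoboundarySquare

variable {S : Type u} [MonoidWithZero S] {n : ℕ}

/-- All the faces of a tuple, numbered from `0` to `n + 1`. -/
def faceTuple (a : Fin (n + 1) → S) (i : Fin (n + 2)) : Fin n → S := fun k =>
  if (k : ℕ) + 1 < i then a k.castSucc
  else if (k : ℕ) + 1 = i then a k.castSucc * a k.succ else a k.succ

def faceLeft (a : Fin (n + 1) → S) (i : Fin (n + 2)) : S := if (i : ℕ) = 0 then a 0 else 1

def faceRight (a : Fin (n + 1) → S) (i : Fin (n + 2)) : S :=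
  if (i : ℕ) = n + 1 then a (Fin.last n) else 1

theorem faceTuple_zero (a : Fin (n + 1) → S) : faceTuple a 0 = Fin.tail a := by
  ext k; simp [faceTuple, Fin.tail]

theorem faceTuple_last (a : Fin (n + 1) → S) : faceTuple a (Fin.last (n + 1)) = Fin.init a := by
  ext k; simp [faceTuple, Fin.init]

theorem faceTuple_mid (a : Fin (n + 1) → S) (i : Fin n) :
    faceTuple a i.castSucc.succ = contract a i := by
  ext k; simp [faceTuple, contract, Fin.contractNth]

theorem face_fac (a : Fin (n + 1) → S) (i : Fin (n + 2)) :
    faceLeft a i * tprod (faceTuple a i) * faceRight a i = tprod a := by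
  induction i using Fin.cases with
  | zero => rw [faceTuple_zero, tprod_succ a]; simp [faceLeft, faceRight]
  | succ i =>
    induction i using Fin.lastCases with
    | last => rw [Fin.succ_last, faceTuple_last, tprod_last a]; simp [faceLeft, faceRight]
    | cast i =>
      have := i.isLt
      rw [faceTuple_mid, tprod_contract]
      simp [faceLeft, faceRight, this.ne]

theorem face_face (a : Fin (n + 2) → S) (i j : Fin (n + 2)) (h : i ≤ j) :
    faceTuple (faceTuple a j.succ) i = faceTuple (faceTuple a i.castSucc) j := by
  ext k
  have h' : (i : ℕ) ≤ j := h
  simp only [faceTuple, Fin.val_castSucc, Fin.val_succ]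
  split_ifs <;> first | rfl | omega | simp [mul_assoc]

theorem faceLeft_faceLeft (a : Fin (n + 2) → S) (i j : Fin (n + 2)) (h : i ≤ j) :
    faceLeft a j.succ * faceLeft (faceTuple a j.succ) i =
      faceLeft a i.castSucc * faceLeft (faceTuple a i.castSucc) j := by
  have h' : (i : ℕ) ≤ j := h
  rcases Nat.eq_zero_or_pos i with hi | hi
  · rcases Nat.eq_zero_or_pos j with hj | hj
    · simp [faceLeft, faceTuple, hi, hj]
    · simp [faceLeft, faceTuple, hi, hj, hj.ne']
  · simp [faceLeft, hi.ne', (hi.trans_le h').ne']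

theorem faceRight_faceRight (a : Fin (n + 2) → S) (i j : Fin (n + 2)) (h : i ≤ j) :
    faceRight (faceTuple a j.succ) i * faceRight a j.succ =
      faceRight (faceTuple a i.castSucc) j * faceRight a i.castSucc := by
  have h' : (i : ℕ) ≤ j := h
  have hi := i.isLt
  have hj := j.isLt
  simp only [faceRight, faceTuple, Fin.val_castSucc, Fin.val_succ, Fin.val_last]
  split_ifs <;> first | contradiction | omega | simp

def Nerve.face (a : Nerve S (n + 1)) (i : Fin (n + 2)) : Nerve S n :=
  ⟨faceTuple a.1 i, fun h => a.2 (by rw [← face_fac a.1 i, h, mul_zero, zero_mul])⟩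

def Nerve.faceHom (a : Nerve S (n + 1)) (i : Fin (n + 2)) : (a.face i).obj ⟶ a.obj :=
  FacHom.mk (faceLeft a.1 i) (faceRight a.1 i) (face_fac a.1 i)

theorem map_congr (D : NatSys S) (f : Cochain D n) {a b : Nerve S n} {c : Fac S}
    (p : FacHom a.obj c) (q : FacHom b.obj c) (h : a = b) (hl : p.left = q.left)
    (hr : p.right = q.right) :
    D.map (X := a.obj) (Y := c) p (f a) = D.map (X := b.obj) (Y := c) q (f b) := by
  subst h
  rw [FacHom.ext hl hr]

theorem coboundary_apply (D : NatSys S) (f : Cochain D n) (a : Nerve S (n + 1)) :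
    coboundary D n f a =
      ∑ i : Fin (n + 2), (-1 : ℤ) ^ (i : ℕ) • D.map (a.faceHom i) (f (a.face i)) := by
  rw [Fin.sum_univ_succ, Fin.sum_univ_castSucc, ← add_assoc]
  simp only [coboundary, AddMonoidHom.coe_mk, ZeroHom.coe_mk]
  congr 1
  · congr 1
    · simp only [Fin.val_zero, pow_zero, one_smul]
      exact map_congr D f _ _ (Subtype.ext (faceTuple_zero a.1).symm) (by simp [Nerve.tailHom, Nerve.faceHom, faceLeft])
        (by simp [Nerve.tailHom, Nerve.faceHom, faceRight])
    · refine Finset.sum_congr rfl fun i _ => ?_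
      have := i.isLt
      congr 1
      exact map_congr D f _ _ (Subtype.ext (faceTuple_mid a.1 i).symm)
        (by simp [Nerve.contractHom, Nerve.faceHom, faceLeft])
        (by simp [Nerve.contractHom, Nerve.faceHom, faceRight, this.ne])
  · congr 1
    exact map_congr D f _ _ (Subtype.ext (by
      rw [Fin.succ_last]; exact (faceTuple_last a.1).symm))
      (by simp [Nerve.initHom, Nerve.faceHom, faceLeft])
      (by simp [Nerve.initHom, Nerve.faceHom, faceRight])

theorem coboundary_coboundary (D : NatSys S) (f : Cochain D n) :
    coboundary D (n + 1) (coboundary D n f) = 0 := by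
  funext a
  rw [coboundary_apply]
  simp only [coboundary_apply, map_sum, map_zsmul]
  refine alternating_sum_eq_zero
    (fun j i => D.map (a.faceHom j) (D.map ((a.face j).faceHom i) (f ((a.face j).face i)))) ?_
  intro i j h
  rw [← ConcreteCategory.comp_apply, ← ConcreteCategory.comp_apply, ← D.map_comp, ← D.map_comp]
  exact map_congr D f _ _ (Subtype.ext (face_face a.1 i j h)) (faceLeft_faceLeft a.1 i j h)
    (faceRight_faceRight a.1 i j h)

end CoboundarySquare

/-- The cochain complex `C⁰(S, D) ⟶ C¹(S, D) ⟶ ⋯`. -/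
def cochainComplex {S : Type u} [MonoidWithZero S] (D : NatSys S) :
    CochainComplex AddCommGrpCat.{u} ℕ :=
  CochainComplex.of (fun n => AddCommGrpCat.of (Cochain D n))
    (fun n => AddCommGrpCat.ofHom (coboundary D n))
    (fun n => by
      ext f x
      exact congrFun (coboundary_coboundary D f) x)

/-- The effect of a morphism of natural systems on cochains. -/
def cochainMap {S : Type u} [MonoidWithZero S] {D E : NatSys S} (φ : D ⟶ E) (n : ℕ) :
    Cochain D n →+ Cochain E n where
  toFun f a := φ.app a.obj (f a)
  map_zero' := by funext a; simp
  map_add' f g := by funext a; simp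

theorem coboundary_cochainMap {S : Type u} [MonoidWithZero S] {D E : NatSys S} (φ : D ⟶ E) (n : ℕ)
    (f : Cochain D n) :
    coboundary E n (cochainMap φ n f) = cochainMap φ (n + 1) (coboundary D n f) := by
  funext a
  have h {b c : Fac S} (p : b ⟶ c) (x : D.obj b) :
      E.map p (φ.app b x) = φ.app c (D.map p x) := by
    rw [← ConcreteCategory.comp_apply, ← ConcreteCategory.comp_apply, φ.naturality]
  simp only [coboundary, cochainMap, AddMonoidHom.coe_mk, ZeroHom.coe_mk, map_add, map_sum,
    map_zsmul, h]

/-- The cochain complex as a functor of the natural system. -/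
def cochainFunctor (S : Type u) [MonoidWithZero S] :
    NatSys S ⥤ CochainComplex AddCommGrpCat.{u} ℕ where
  obj D := cochainComplex D
  map {D E} φ := CochainComplex.ofHom
    (fun n => AddCommGrpCat.ofHom (cochainMap φ n))
    (fun n => by
      simp only [cochainComplex, CochainComplex.of_d]
      apply AddCommGrpCat.hom_ext
      ext f x
      exact congrFun (coboundary_cochainMap φ n f) x)
  map_id D := by
    ext n f
    rfl
  map_comp φ ψ := by
    ext n f
    rfl

/-- The functor `Hⁿ(S, -)`. -/
def cohomology (S : Type u) [MonoidWithZero S] (n : ℕ) : NatSys S ⥤ AddCommGrpCat.{u} :=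
  cochainFunctor S ⋙ HomologicalComplex.homologyFunctor _ _ n

/-! ### The bar resolution -/

/-- The symbols `[a₀, …, aₙ₊₁]` with `a₀ ⋯ aₙ₊₁ = a`. -/
def Symbol {S : Type u} [MonoidWithZero S] (n : ℕ) (a : Fac S) : Type u :=
  {t : Fin (n + 2) → S // tprod t = a.val}

/-- `[a₀, …, aₙ₊₁] ↦ [α a₀, a₁, …, aₙ, aₙ₊₁ β]`. -/
def Symbol.map {S : Type u} [MonoidWithZero S] {n : ℕ} {a b : Fac S} (f : a ⟶ b)
    (t : Symbol n a) : Symbol n b :=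
  ⟨actTuple f.left f.right t.1, by rw [tprod_actTuple, t.2]; exact f.fac⟩

/-- `[a₀, …, aₙ₊₂] ↦ [a₀, …, aᵢ aᵢ₊₁, …, aₙ₊₂]`. -/
def Symbol.face {S : Type u} [MonoidWithZero S] {n : ℕ} {a : Fac S} (t : Symbol (n + 1) a)
    (i : Fin (n + 2)) : Symbol n a :=
  ⟨contract t.1 i, by rw [tprod_contract, t.2]⟩

/-- The natural system `Bₙ`, whose value at `a` is free abelian on the symbols
`[a₀, …, aₙ₊₁]` with `a₀ ⋯ aₙ₊₁ = a`. -/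
def bar (S : Type u) [MonoidWithZero S] (n : ℕ) : NatSys S where
  obj a := AddCommGrpCat.of (FreeAbelianGroup (Symbol n a))
  map f := AddCommGrpCat.ofHom (FreeAbelianGroup.map (Symbol.map f))
  map_id a := by
    have h : Symbol.map (𝟙 a) = (id : Symbol n a → Symbol n a) := by
      funext t
      refine Subtype.ext (funext fun i => ?_)
      change (if i = 0 then (1 : S) else 1) * t.1 i * (if i = Fin.last (n + 1) then 1 else 1) = t.1 i
      simp
    rw [h, FreeAbelianGroup.map_id]
    rfl
  map_comp {a b c} f g := by
    have h : Symbol.map (f ≫ g) =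
        (Symbol.map g : Symbol n b → Symbol n c) ∘ (Symbol.map f : Symbol n a → Symbol n b) := by
      funext t
      refine Subtype.ext (funext fun i => ?_)
      change (if i = 0 then g.left * f.left else 1) * t.1 i *
        (if i = Fin.last (n + 1) then f.right * g.right else 1) =
        (if i = 0 then g.left else 1) * ((if i = 0 then f.left else 1) * t.1 i *
        (if i = Fin.last (n + 1) then f.right else 1)) *
        (if i = Fin.last (n + 1) then g.right else 1)
      split_ifs <;> simp [mul_assoc]
    rw [h, FreeAbelianGroup.map_comp]
    rfl

/-- `[a₀, …, aₙ₊₂] ↦ ∑ i, (-1) ^ i [a₀, …, aᵢ aᵢ₊₁, …, aₙ₊₂]`, where `0 ≤ i ≤ n + 1`. -/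
def barBoundaryAt {S : Type u} [MonoidWithZero S] (n : ℕ) (a : Fac S) :
    FreeAbelianGroup (Symbol (n + 1) a) →+ FreeAbelianGroup (Symbol n a) :=
  FreeAbelianGroup.lift fun t =>
    ∑ i : Fin (n + 2), (-1 : ℤ) ^ (i : ℕ) • FreeAbelianGroup.of (t.face i)

/-- The boundary `Bₙ₊₁ ⟶ Bₙ`. -/
def barBoundary (S : Type u) [MonoidWithZero S] (n : ℕ) : bar S (n + 1) ⟶ bar S n where
  app a := AddCommGrpCat.ofHom (barBoundaryAt n a)
  naturality a b f := by
    apply AddCommGrpCat.hom_ext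
    apply FreeAbelianGroup.lift_ext
    intro t
    change barBoundaryAt n b (FreeAbelianGroup.map (Symbol.map f) (FreeAbelianGroup.of t)) =
      FreeAbelianGroup.map (Symbol.map f) (barBoundaryAt n a (FreeAbelianGroup.of t))
    have h (i : Fin (n + 2)) : (Symbol.map f t).face i = Symbol.map f (t.face i) :=
      Subtype.ext (contract_actTuple _ _ _ _)
    simp [barBoundaryAt, FreeAbelianGroup.map_of_apply, map_sum, map_zsmul, h]

/-- The bar complex `⋯ ⟶ B₁ ⟶ B₀`. -/
def barComplex (S : Type u) [MonoidWithZero S] : ChainComplex (NatSys S) ℕ :=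
  ChainComplex.of (bar S) (barBoundary S) (fun n => by
    ext a : 2
    apply AddCommGrpCat.hom_ext
    apply FreeAbelianGroup.lift_ext
    intro t
    change barBoundaryAt n a (barBoundaryAt (n + 1) a (FreeAbelianGroup.of t)) = 0
    simp only [barBoundaryAt, FreeAbelianGroup.lift_apply_of, map_sum, map_zsmul]
    exact alternating_sum_eq_zero (fun j i => FreeAbelianGroup.of ((t.face j).face i))
      (fun i j h => congrArg _ (Subtype.ext (contract_contract t.1 i j h))))

/-- `B₀ ⟶ ℤ`, sending each symbol `[a₀, a₁]` to the generator. -/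
def barAugmentation₀ (S : Type u) [MonoidWithZero S] : bar S 0 ⟶ trivialSystem S where
  app a := AddCommGrpCat.ofHom (FreeAbelianGroup.lift fun _ => ULift.up 1)
  naturality a b f := by
    apply AddCommGrpCat.hom_ext
    apply FreeAbelianGroup.lift_ext
    intro t
    change FreeAbelianGroup.lift (fun _ => (ULift.up 1 : ULift.{u} ℤ))
      (FreeAbelianGroup.map (Symbol.map f) (FreeAbelianGroup.of t)) =
      FreeAbelianGroup.lift (fun _ => (ULift.up 1 : ULift.{u} ℤ)) (FreeAbelianGroup.of t)
    simp [FreeAbelianGroup.map_of_apply]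

/-- The augmentation of the bar complex, as a chain map to `ℤ` placed in degree `0`. -/
def barAugmentation (S : Type u) [MonoidWithZero S] :
    barComplex S ⟶ (ChainComplex.single₀ (NatSys S)).obj (trivialSystem S) :=
  (ChainComplex.toSingle₀Equiv _ _).symm ⟨barAugmentation₀ S, by
    have h : (barComplex S).d 1 0 = barBoundary S 0 := ChainComplex.of_d (bar S) (barBoundary S) 0
    rw [h]
    ext a : 2
    apply AddCommGrpCat.hom_ext
    apply FreeAbelianGroup.lift_ext
    intro t
    change FreeAbelianGroup.lift (fun _ => (ULift.up 1 : ULift.{u} ℤ))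
      (barBoundaryAt 0 a (FreeAbelianGroup.of t)) = 0
    simp [barBoundaryAt, Fin.sum_univ_two]⟩

/-! ### 0-modules and 0-cohomology -/

/-- A (unital) 0-module over the monoid `S` with zero: an abelian group on which the nonzero
elements of `S` act by endomorphisms, with `s (t a) = (s t) a` whenever `s t ≠ 0`, and with `1`
acting as the identity. -/
structure ZeroModule (S : Type u) [MonoidWithZero S] : Type (u + 1) where
  carrier : Type u
  [grp : AddCommGroup carrier]
  act : ∀ s : S, s ≠ 0 → (carrier →+ carrier)
  act_act : ∀ (s t : S) (hs : s ≠ 0) (ht : t ≠ 0) (hst : s * t ≠ 0) (a : carrier),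
    act s hs (act t ht a) = act (s * t) hst a
  act_one : ∀ (h : (1 : S) ≠ 0) (a : carrier), act 1 h a = a

attribute [instance] ZeroModule.grp

/-- Morphisms of 0-modules: equivariant additive maps. -/
@[ext]
structure ZeroModuleHom {S : Type u} [MonoidWithZero S] (A B : ZeroModule S) : Type u where
  toHom : A.carrier →+ B.carrier
  map_act : ∀ (s : S) (hs : s ≠ 0) (a : A.carrier), toHom (A.act s hs a) = B.act s hs (toHom a)

instance (S : Type u) [MonoidWithZero S] : Category.{u} (ZeroModule S) where
  Hom A B := ZeroModuleHom A B
  id A := ⟨AddMonoidHom.id _, fun _ _ _ => rfl⟩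
  comp f g := ⟨g.toHom.comp f.toHom, fun s hs a => by simp [f.map_act, g.map_act]⟩

section ZeroCohomology

variable {S : Type u} [MonoidWithZero S]

theorem FacHom.left_ne_zero {a b : Fac S} (f : FacHom a b) : f.left ≠ 0 := fun h =>
  b.ne_zero (by rw [← f.fac, h, zero_mul, zero_mul])

/-- A 0-module `A` viewed as a natural system: constant value `A`, the morphism `(α, β)` acting
as `a ↦ α a`. -/
def ZeroModule.toNatSys (A : ZeroModule S) : NatSys S where
  obj _ := AddCommGrpCat.of A.carrier
  map {a b} f := AddCommGrpCat.ofHom (A.act f.left (FacHom.left_ne_zero f))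
  map_id a := by
    ext x
    exact A.act_one _ x
  map_comp {a b c} f g := by
    ext x
    exact (A.act_act _ _ _ _ _ x).symm

/-- The functor from 0-modules to natural systems. -/
def zeroModuleToNatSys (S : Type u) [MonoidWithZero S] : ZeroModule S ⥤ NatSys S where
  obj A := A.toNatSys
  map {A B} φ :=
    { app := fun _ => AddCommGrpCat.ofHom φ.toHom
      naturality := fun a b f => by
        ext x
        exact φ.map_act _ _ x }

/-- The group of `n`-dimensional 0-cochains: partial `n`-place maps to `A`, defined on the tuples
with nonzero product. -/
abbrev ZeroCochain (A : ZeroModule S) (n : ℕ) : Type u := Nerve S n → A.carrier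

theorem Nerve.head_ne_zero {n : ℕ} (a : Nerve S (n + 1)) : a.1 0 ≠ 0 := fun h =>
  a.2 (by rw [tprod_succ, h, zero_mul])

/-- The coboundary of 0-cochains.  The sum over `1 ≤ i ≤ n` is indexed by `i - 1 : Fin n`. -/
def zeroCoboundary (A : ZeroModule S) (n : ℕ) : ZeroCochain A n →+ ZeroCochain A (n + 1) where
  toFun f a :=
    A.act (a.1 0) a.head_ne_zero (f a.tail) +
      ∑ i : Fin n, (-1 : ℤ) ^ ((i : ℕ) + 1) • f (a.contract i) +
      (-1 : ℤ) ^ (n + 1) • f a.init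
  map_zero' := by
    funext a
    simp
  map_add' f g := by
    funext a
    simp only [Pi.add_apply, map_add, smul_add, Finset.sum_add_distrib]
    abel

theorem zeroCoboundary_eq (A : ZeroModule S) (n : ℕ) (f : ZeroCochain A n) :
    zeroCoboundary A n f = coboundary A.toNatSys n f := by
  funext a
  have h (b c : Fac S) (p : b ⟶ c) (hp : FacHom.left p = 1) (x : A.carrier) :
      A.toNatSys.map p x = x := by
    change A.act (FacHom.left p) _ x = x
    have key : ∀ (s : S) (hs : s ≠ 0), s = 1 → A.act s hs x = x := by
      rintro s hs rfl
      exact A.act_one hs x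
    exact key _ _ hp
  have h1 (i : Fin n) := h _ _ (a.contractHom i) rfl (f (a.contract i))
  have h2 := h _ _ a.initHom rfl (f a.init)
  change _ = A.toNatSys.map a.tailHom (f a.tail) +
      ∑ i : Fin n, (-1 : ℤ) ^ ((i : ℕ) + 1) • A.toNatSys.map (a.contractHom i) (f (a.contract i)) +
      (-1 : ℤ) ^ (n + 1) • A.toNatSys.map a.initHom (f a.init)
  simp only [h1, h2]
  rfl

theorem zeroCoboundary_zeroCoboundary (A : ZeroModule S) (n : ℕ) (f : ZeroCochain A n) :
    zeroCoboundary A (n + 1) (zeroCoboundary A n f) = 0 := by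
  rw [zeroCoboundary_eq A (n + 1), zeroCoboundary_eq A n]
  exact coboundary_coboundary A.toNatSys f

/-- The complex of 0-cochains. -/
def zeroCochainComplex (A : ZeroModule S) : CochainComplex AddCommGrpCat.{u} ℕ :=
  CochainComplex.of (fun n => AddCommGrpCat.of (ZeroCochain A n))
    (fun n => AddCommGrpCat.ofHom (zeroCoboundary A n))
    (fun n => by
      ext f x
      exact congrFun (zeroCoboundary_zeroCoboundary A n f) x)

/-- The complex of 0-cochains as a functor of the 0-module. -/
def zeroCochainFunctor (S : Type u) [MonoidWithZero S] :
    ZeroModule S ⥤ CochainComplex AddCommGrpCat.{u} ℕ where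
  obj A := zeroCochainComplex A
  map {A B} φ := CochainComplex.ofHom
    (fun n => AddCommGrpCat.ofHom (φ.toHom.compLeft (Nerve S n)))
    (fun n => by
      simp only [zeroCochainComplex, CochainComplex.of_d]
      apply AddCommGrpCat.hom_ext
      ext f x
      change zeroCoboundary B n (φ.toHom ∘ f) x = φ.toHom (zeroCoboundary A n f x)
      simp [zeroCoboundary, φ.map_act])
  map_id A := by
    ext n f
    rfl
  map_comp φ ψ := by
    ext n f
    rfl

/-- The functor `H₀ⁿ(S, -)` on 0-modules. -/
def zeroCohomology (S : Type u) [MonoidWithZero S] (n : ℕ) :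
    ZeroModule S ⥤ AddCommGrpCat.{u} :=
  zeroCochainFunctor S ⋙ HomologicalComplex.homologyFunctor _ _ n

end ZeroCohomology

end FacCohomology

end

/-!
A symbol `[a₀, a₁, …, aₙ, aₙ₊₁]` is the image of `[1, a₁, …, aₙ, 1]` under the morphism
`(a₀, aₙ₊₁)`, in exactly one way. Hence a morphism `Bₙ ⟶ D` is an arbitrary choice of values on the
symbols `[1, a₁, …, aₙ, 1]`, that is, an `n`-cochain: `Hom(Bₙ, D) = Cⁿ(S, D)`. Cochains lift along
epimorphisms, so `Bₙ` is projective, and the boundary of `B` induces the coboundary of `C(S, D)`.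
At each object, prepending `1` to a symbol contracts the augmented bar complex (this contraction is
not natural), so `B` is a projective resolution of `ℤ` and `Hom(B, D)` computes `Ext(ℤ, D)`. The
complex of 0-cochains of a 0-module is the cochain complex of the associated natural system.
-/

universe v w

noncomputable section

namespace FacCohomology

open Abelian

section LeftHomology

variable {T T' : ShortComplex AddCommGrpCat.{w}} {H H' : AddCommGrpCat.{w}}

/-- Left homology data of a short complex of abelian groups: its homology is any group `H` that
receives the cycles surjectively with the boundaries as kernel. -/
def leftHomologyDataOfSurjective (π : AddMonoidHom.ker T.g.hom →+ H)
    (hπ : Function.Surjective π) (hker : ∀ z, π z = 0 ↔ ∃ x, T.f x = z) :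
    T.LeftHomologyData where
  K := AddCommGrpCat.of (AddMonoidHom.ker T.g.hom)
  H := H
  i := T.abLeftHomologyData.i
  π := AddCommGrpCat.ofHom π
  wi := T.abLeftHomologyData.wi
  hi := T.abLeftHomologyData.hi
  wπ := by
    ext x
    exact (hker _).2 ⟨x, rfl⟩
  hπ := by
    let W : ShortComplex AddCommGrpCat.{w} :=
      ShortComplex.mk (AddCommGrpCat.ofHom T.abToCycles) (AddCommGrpCat.ofHom π) (by
        ext x
        exact (hker _).2 ⟨x, rfl⟩)
    have hW : W.Exact := (ShortComplex.ab_exact_iff _).2 fun z hz => by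
      obtain ⟨x, hx⟩ := (hker z).1 hz
      exact ⟨x, Subtype.ext hx⟩
    have : Epi W.g := (AddCommGrpCat.epi_iff_surjective _).2 hπ
    exact hW.gIsCokernel

/-- The map induced on cycles by a morphism of short complexes of abelian groups. -/
def kerMap (φ : T ⟶ T') : AddMonoidHom.ker T.g.hom →+ AddMonoidHom.ker T'.g.hom :=
  (φ.τ₂.hom.comp (AddSubgroup.subtype _)).codRestrict _ fun z =>
    calc T'.g (φ.τ₂ z) = φ.τ₃ (T.g z) := ConcreteCategory.congr_hom φ.comm₂₃ z.1
      _ = 0 := by rw [AddMonoidHom.mem_ker.1 z.2, map_zero]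

/-- A map between groups computing homology, compatible with the maps on cycles, computes the map
on homology. -/
def leftHomologyMapDataOfSurjective (φ : T ⟶ T')
    {π : AddMonoidHom.ker T.g.hom →+ H} (hπ : Function.Surjective π)
    (hker : ∀ z, π z = 0 ↔ ∃ x, T.f x = z)
    {π' : AddMonoidHom.ker T'.g.hom →+ H'} (hπ' : Function.Surjective π')
    (hker' : ∀ z, π' z = 0 ↔ ∃ x, T'.f x = z)
    (ψ : H ⟶ H') (hψ : ∀ z, ψ (π z) = π' (kerMap φ z)) :
    ShortComplex.LeftHomologyMapData φ
      (leftHomologyDataOfSurjective π hπ hker) (leftHomologyDataOfSurjective π' hπ' hker') where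
  φK := AddCommGrpCat.ofHom (kerMap φ)
  φH := ψ
  commi := rfl
  commf' := by
    ext x
    exact Subtype.ext (ConcreteCategory.congr_hom φ.comm₁₂ x).symm
  commπ := by
    ext z
    exact hψ z

end LeftHomology

section ExtOfResolution

variable {C : Type u} [Category.{v} C]

/-- The functor `Y ↦ Hom(K, Y)` into cochain complexes, for a chain complex `K`; its differentials
carry no signs. -/
def homFunctor [Preadditive C] (K : ChainComplex C ℕ) :
    C ⥤ CochainComplex AddCommGrpCat.{v} ℕ where
  obj Y :=
    { X := fun n => AddCommGrpCat.of (K.X n ⟶ Y)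
      d := fun i j => AddCommGrpCat.ofHom (Preadditive.leftComp Y (K.d j i))
      shape := fun i j h => by
        ext f
        simp [Preadditive.leftComp, K.shape j i h]
      d_comp_d' := fun i j k _ _ => by
        ext f
        simp [Preadditive.leftComp] }
  map g :=
    { f := fun n => AddCommGrpCat.ofHom (Preadditive.rightComp (K.X n) g)
      comm' := fun i j _ => by
        ext f
        exact (Category.assoc _ _ _).symm }
  map_id Y := by
    ext n f
    exact Category.comp_id f
  map_comp g h := by
    ext n f
    exact (Category.assoc _ _ _).symm

variable [Abelian C] [HasExt.{w} C] {X Y : C} (R : ProjectiveResolution X)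

theorem extMk_zero_eq_zero_iff (f : R.complex.X 0 ⟶ Y) (m : ℕ) (hm : 0 + 1 = m)
    (hf : R.complex.d m 0 ≫ f = 0) : R.extMk f m hm hf = 0 ↔ f = 0 := by
  refine ⟨fun h => ?_, by rintro rfl; exact R.extMk_zero m hm⟩
  rw [← R.extEquivCohomologyClass.apply_eq_iff_eq,
    ProjectiveResolution.extEquivCohomologyClass_extMk,
    ProjectiveResolution.extEquivCohomologyClass_zero,
    CochainComplex.HomComplex.CohomologyClass.mk_eq_zero_iff,
    CochainComplex.HomComplex.Cocycle.toSingleMk_mem_coboundaries_iff _ _ _ _ _ 1 (by simp)] at h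
  obtain ⟨g, hg⟩ := h
  have hg0 : g = 0 :=
    (CochainComplex.isZero_of_isStrictlyLE R.cochainComplex 0 1).eq_of_src g 0
  rw [hg0, Limits.comp_zero] at hg
  rw [← cancel_epi (R.cochainComplexXIso (-(0 : ℕ)) 0 rfl).hom, Limits.comp_zero]
  exact hg.symm

theorem extMk_eq_zero_iff_exists {n : ℕ} (f : R.complex.X n ⟶ Y) (m : ℕ) (hm : n + 1 = m)
    (hf : R.complex.d m n ≫ f = 0) :
    R.extMk f m hm hf = 0 ↔
      ∃ g : R.complex.X ((ComplexShape.up ℕ).prev n) ⟶ Y, R.complex.d n _ ≫ g = f := by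
  cases n with
  | zero =>
    rw [extMk_zero_eq_zero_iff, CochainComplex.prev_nat_zero, R.complex.shape 0 0 (by simp)]
    simp only [Limits.zero_comp, exists_const, eq_comm]
  | succ p =>
    rw [CochainComplex.prev_nat_succ]
    exact R.extMk_eq_zero_iff f m hm hf p rfl

/-- The class in `Ext X Y n` of a cocycle of `Hom(R, Y)`, as a homomorphism. -/
def cocycleToExt (Y : C) (n : ℕ) :
    AddMonoidHom.ker (((homFunctor R.complex).obj Y).sc n).g.hom →+ Ext X Y n :=
  AddMonoidHom.mk' (fun f => R.extMk f.1 _ (CochainComplex.next ℕ n).symm f.2)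
    fun f g => (R.add_extMk f.1 g.1 _ _ f.2 g.2).symm

theorem cocycleToExt_surjective (Y : C) (n : ℕ) : Function.Surjective (cocycleToExt R Y n) := by
  intro α
  obtain ⟨f, hf, rfl⟩ := R.extMk_surjective α _ (CochainComplex.next ℕ n).symm
  exact ⟨⟨f, hf⟩, rfl⟩

theorem cocycleToExt_eq_zero_iff {Y : C} {n : ℕ}
    (f : AddMonoidHom.ker (((homFunctor R.complex).obj Y).sc n).g.hom) :
    cocycleToExt R Y n f = 0 ↔ ∃ g, (((homFunctor R.complex).obj Y).sc n).f g = f :=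
  extMk_eq_zero_iff_exists R f.1 _ (CochainComplex.next ℕ n).symm f.2

theorem map_cocycleToExt {Y Z : C} {n : ℕ} (g : Y ⟶ Z)
    (f : AddMonoidHom.ker (((homFunctor R.complex).obj Y).sc n).g.hom) :
    (extFunctorObj X n).map g (cocycleToExt R Y n f) =
      cocycleToExt R Z n (kerMap ((HomologicalComplex.shortComplexFunctor _ _ n).map
        ((homFunctor R.complex).map g)) f) :=
  R.extMk_comp_mk₀ f.1 _ (CochainComplex.next ℕ n).symm f.2 g

end ExtOfResolution

/-- The homology of `Hom(R, Y)` is `Ext X Y n`, naturally in `Y`. -/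
def homologyHomFunctorIso {C : Type u} [Category.{v} C] [Abelian C] [HasExt.{v} C] {X : C}
    (R : ProjectiveResolution X) (n : ℕ) :
    homFunctor R.complex ⋙ HomologicalComplex.homologyFunctor _ _ n ≅ extFunctorObj.{v} X n :=
  NatIso.ofComponents
    (fun Y => (leftHomologyDataOfSurjective (H := (extFunctorObj X n).obj Y)
      (cocycleToExt R Y n) (cocycleToExt_surjective R Y n)
      (cocycleToExt_eq_zero_iff R)).homologyIso)
    fun {Y Z} g => (leftHomologyMapDataOfSurjective
      ((HomologicalComplex.shortComplexFunctor _ _ n).map ((homFunctor R.complex).map g))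
      (cocycleToExt_surjective R Y n) (cocycleToExt_eq_zero_iff R)
      (cocycleToExt_surjective R Z n) (cocycleToExt_eq_zero_iff R)
      ((extFunctorObj X n).map g) (map_cocycleToExt R g)).homologyMap_comm

section Exactness

theorem exact_of_exact_evaluation {J : Type*} [Category* J] {V : Type*} [Category* V] [Abelian V]
    (T : ShortComplex (J ⥤ V)) (h : ∀ j, (T.map ((evaluation J V).obj j)).Exact) : T.Exact := by
  rw [ShortComplex.exact_iff_isZero_homology]
  refine Functor.isZero _ fun j => ?_
  exact Limits.IsZero.of_iso ((ShortComplex.exact_iff_isZero_homology _).1 (h j))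
    (T.mapHomologyIso ((evaluation J V).obj j)).symm

theorem quasiIso_toSingle₀Equiv_symm {C : Type*} [Category* C] [Abelian C]
    {K : ChainComplex C ℕ} {X : C} {ε : K.X 0 ⟶ X} (hε : Epi ε) (w : K.d 1 0 ≫ ε = 0)
    (hw : (ShortComplex.mk _ _ w).Exact) (hK : ∀ n, K.ExactAt (n + 1)) :
    QuasiIso ((K.toSingle₀Equiv X).symm ⟨ε, w⟩) := by
  rw [quasiIso_iff]
  rintro (_ | n)
  · have h0 : ((K.toSingle₀Equiv X).symm ⟨ε, w⟩).f 0 = ε :=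
      ChainComplex.toSingle₀Equiv_symm_apply_f_zero _ _
    rw [quasiIsoAt_iff' _ 1 0 0 (by simp) (by simp), ShortComplex.quasiIso_iff_of_zeros'
      _ (K.shape _ _ (by simp)) rfl rfl]
    constructor
    · exact ShortComplex.exact_of_iso (ShortComplex.isoMk (Iso.refl (K.X 1)) (Iso.refl (K.X 0))
        (Iso.refl X) ((Category.id_comp _).trans (Category.comp_id _).symm)
        ((Category.id_comp _).trans (h0.trans (Category.comp_id _).symm))) hw
    · change Epi (((K.toSingle₀Equiv X).symm ⟨ε, w⟩).f 0)
      rwa [h0]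
  · rw [quasiIsoAt_iff_exactAt' _ _ (ChainComplex.exactAt_succ_single_obj _ _)]
    exact hK n

end Exactness

section Tuples

theorem tail_snoc {α : Type*} {n : ℕ} (x : Fin (n + 1) → α) (r : α) :
    Fin.tail (Fin.snoc x r : Fin (n + 2) → α) = Fin.snoc (Fin.tail x) r := by
  conv_lhs => rw [← Fin.cons_self_tail x, ← Fin.cons_snoc_eq_snoc_cons, Fin.tail_cons]

variable {S : Type u} [Monoid S] {n : ℕ}

theorem contract_cons_zero (l : S) (x : Fin (n + 1) → S) :
    contract (Fin.cons l x : Fin (n + 2) → S) 0 = Fin.cons (l * x 0) (Fin.tail x) := by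
  funext k
  cases k using Fin.cases <;> simp [contract, Fin.contractNth, Fin.tail]

theorem contract_cons_succ (l : S) (x : Fin (n + 1) → S) (i : Fin n) :
    contract (Fin.cons l x : Fin (n + 2) → S) i.succ = Fin.cons l (contract x i) := by
  funext k
  cases k using Fin.cases <;> simp [contract, Fin.contractNth]

theorem contract_snoc_castSucc (x : Fin (n + 1) → S) (r : S) (i : Fin n) :
    contract (Fin.snoc x r : Fin (n + 2) → S) i.castSucc = Fin.snoc (contract x i) r := by
  funext k
  cases k using Fin.lastCases with
  | last =>
    have := i.isLt
    simp [contract, Fin.contractNth, this.not_gt, this.ne']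
  | cast k => simp [contract, Fin.contractNth, ← Fin.castSucc_succ]

theorem contract_snoc_last (x : Fin (n + 1) → S) (r : S) :
    contract (Fin.snoc x r : Fin (n + 2) → S) (Fin.last n) =
      Fin.snoc (Fin.init x) (x (Fin.last n) * r) := by
  funext k
  cases k using Fin.lastCases <;> simp [contract, Fin.contractNth, Fin.init]

theorem tprod_cons_snoc (l r : S) (x : Fin n → S) :
    tprod (Fin.cons l (Fin.snoc x r : Fin (n + 1) → S) : Fin (n + 2) → S) = l * tprod x * r := by
  rw [tprod_succ, Fin.cons_zero, Fin.tail_cons, tprod_last, Fin.init_snoc, Fin.snoc_last, mul_assoc]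

theorem tprod_eq_mul_mul (x : Fin (n + 2) → S) :
    tprod x = x 0 * tprod (Fin.init (Fin.tail x)) * x (Fin.last (n + 1)) := by
  rw [tprod_succ, tprod_last (Fin.tail x), mul_assoc]
  rfl

end Tuples

section Symbols

variable {S : Type u} [MonoidWithZero S] {n : ℕ}

/-- The symbol `[α, a₁, …, aₙ, β]` given by a morphism `(α, β) : a₁ ⋯ aₙ ⟶ a`. -/
def Symbol.ofHom {a : Fac S} (x : Nerve S n) (g : x.obj ⟶ a) : Symbol n a :=
  ⟨Fin.cons g.left (Fin.snoc x.1 g.right : Fin (n + 1) → S),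
    (tprod_cons_snoc _ _ _).trans g.fac⟩

/-- The symbol `[1, a₁, …, aₙ, 1]`. -/
def Nerve.symbol (x : Nerve S n) : Symbol n x.obj := Symbol.ofHom x (𝟙 _)

/-- The inner part `(a₁, …, aₙ)` of the symbol `[a₀, …, aₙ₊₁]`. -/
def Symbol.inner {a : Fac S} (t : Symbol n a) : Nerve S n :=
  ⟨Fin.init (Fin.tail t.1), fun h => a.ne_zero (by
    rw [← t.2, tprod_eq_mul_mul, h, mul_zero, zero_mul])⟩

/-- The morphism `(a₀, aₙ₊₁) : a₁ ⋯ aₙ ⟶ a₀ ⋯ aₙ₊₁`. -/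
def Symbol.innerHom {a : Fac S} (t : Symbol n a) : t.inner.obj ⟶ a :=
  FacHom.mk (t.1 0) (t.1 (Fin.last (n + 1))) ((tprod_eq_mul_mul t.1).symm.trans t.2)

theorem Symbol.ofHom_innerHom {a : Fac S} (t : Symbol n a) : ofHom t.inner t.innerHom = t := by
  refine Subtype.ext ?_
  change Fin.cons (t.1 0) (Fin.snoc (Fin.init (Fin.tail t.1)) (Fin.tail t.1 (Fin.last n))) = t.1
  rw [Fin.snoc_init_self, Fin.cons_self_tail]

theorem Symbol.exists_ofHom_eq {a : Fac S} (t : Symbol n a) :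
    ∃ (x : Nerve S n) (g : x.obj ⟶ a), ofHom x g = t :=
  ⟨t.inner, t.innerHom, t.ofHom_innerHom⟩

theorem Symbol.map_ofHom {a b : Fac S} (x : Nerve S n) (g : x.obj ⟶ a) (h : a ⟶ b) :
    map h (ofHom x g) = ofHom x (g ≫ h) := by
  refine Subtype.ext (funext fun k => ?_)
  change actTuple h.left h.right (Fin.cons g.left (Fin.snoc x.1 g.right : Fin (n + 1) → S)) k =
    (Fin.cons (h.left * g.left) (Fin.snoc x.1 (g.right * h.right) : Fin (n + 1) → S) :
      Fin (n + 2) → S) k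
  cases k using Fin.cases with
  | zero => simp [actTuple, Fin.ext_iff]
  | succ k =>
    cases k using Fin.lastCases with
    | last => simp [actTuple, Fin.ext_iff]
    | cast k => simp [actTuple, Fin.ext_iff, k.isLt.ne]

theorem contract_cons_snoc (l r : S) (x : Fin (n + 1) → S) (i : Fin (n + 2)) :
    contract (Fin.cons l (Fin.snoc x r : Fin (n + 2) → S) : Fin (n + 3) → S) i =
      Fin.cons (l * faceLeft x i) (Fin.snoc (faceTuple x i) (faceRight x i * r) :
        Fin (n + 1) → S) := by
  cases i using Fin.cases with
  | zero =>
    rw [contract_cons_zero, faceTuple_zero]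
    simp [faceLeft, faceRight, tail_snoc]
  | succ i =>
    rw [contract_cons_succ]
    cases i using Fin.lastCases with
    | last =>
      rw [contract_snoc_last, Fin.succ_last, faceTuple_last]
      simp [faceLeft, faceRight]
    | cast i =>
      rw [contract_snoc_castSucc, faceTuple_mid]
      simp [faceLeft, faceRight, i.isLt.ne]

theorem Symbol.face_ofHom {a : Fac S} (x : Nerve S (n + 1)) (g : x.obj ⟶ a) (i : Fin (n + 2)) :
    (ofHom x g).face i = ofHom (x.face i) (x.faceHom i ≫ g) :=
  Subtype.ext (contract_cons_snoc _ _ _ _)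

theorem Nerve.map_symbol {a : Fac S} (x : Nerve S n) (g : x.obj ⟶ a) :
    Symbol.map g x.symbol = Symbol.ofHom x g := by
  rw [symbol, Symbol.map_ofHom, Category.id_comp]

theorem Nerve.face_symbol (x : Nerve S (n + 1)) (i : Fin (n + 2)) :
    x.symbol.face i = Symbol.map (x.faceHom i) (x.face i).symbol := by
  rw [symbol, Symbol.face_ofHom, Category.comp_id, map_symbol]

end Symbols

section HomBar

variable {S : Type u} [MonoidWithZero S] {n : ℕ} {D E : NatSys S}

/-- The element `a₀⁎ aₙ₊₁^* f (a₁, …, aₙ)` attached to a cochain `f` and a symbol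
`[a₀, …, aₙ₊₁]`. -/
def Cochain.eval (f : Cochain D n) {a : Fac S} (t : Symbol n a) : D.obj a :=
  D.map t.innerHom (f t.inner)

theorem Cochain.eval_ofHom (f : Cochain D n) {a : Fac S} (x : Nerve S n) (g : x.obj ⟶ a) :
    f.eval (Symbol.ofHom x g) = D.map g (f x) :=
  map_congr D f _ _ (Subtype.ext (Fin.init_snoc (α := fun _ => S) _ _)) rfl
    (Fin.snoc_last (α := fun _ => S) _ _)

theorem Cochain.eval_map (f : Cochain D n) {a b : Fac S} (g : a ⟶ b) (t : Symbol n a) :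
    f.eval (Symbol.map g t) = D.map g (f.eval t) := by
  obtain ⟨x, h, rfl⟩ := t.exists_ofHom_eq
  rw [Symbol.map_ofHom, eval_ofHom, eval_ofHom, D.map_comp, ConcreteCategory.comp_apply]

/-- The cochain `(a₁, …, aₙ) ↦ φ [1, a₁, …, aₙ, 1]`. -/
def cochainOfHom (φ : bar S n ⟶ D) : Cochain D n := fun x =>
  φ.app x.obj (FreeAbelianGroup.of x.symbol)

/-- The morphism `Bₙ ⟶ D` sending `[a₀, …, aₙ₊₁]` to `a₀⁎ aₙ₊₁^* f (a₁, …, aₙ)`. -/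
def homOfCochain (f : Cochain D n) : bar S n ⟶ D where
  app a := AddCommGrpCat.ofHom (FreeAbelianGroup.lift f.eval)
  naturality a b g := by
    apply AddCommGrpCat.hom_ext
    apply FreeAbelianGroup.lift_ext
    intro t
    change FreeAbelianGroup.lift f.eval (FreeAbelianGroup.map (Symbol.map g) (.of t)) =
      D.map g (FreeAbelianGroup.lift f.eval (.of t))
    rw [FreeAbelianGroup.map_of_apply, FreeAbelianGroup.lift_apply_of,
      FreeAbelianGroup.lift_apply_of, f.eval_map]

theorem homOfCochain_app_of (f : Cochain D n) {a : Fac S} (t : Symbol n a) :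
    (homOfCochain f).app a (FreeAbelianGroup.of t) = f.eval t :=
  FreeAbelianGroup.lift_apply_of _ _

theorem hom_app_of_map (φ : bar S n ⟶ D) {a b : Fac S} (g : a ⟶ b) (t : Symbol n a) :
    φ.app b (FreeAbelianGroup.of (Symbol.map g t)) =
      D.map g (φ.app a (FreeAbelianGroup.of t)) :=
  calc φ.app b (FreeAbelianGroup.of (Symbol.map g t))
      _ = φ.app b ((bar S n).map g (FreeAbelianGroup.of t)) :=
        congrArg (φ.app b) (FreeAbelianGroup.map_of_apply t).symm
      _ = D.map g (φ.app a (FreeAbelianGroup.of t)) :=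
        ConcreteCategory.congr_hom (φ.naturality g) _

theorem cochainOfHom_homOfCochain (f : Cochain D n) : cochainOfHom (homOfCochain f) = f := by
  funext x
  calc cochainOfHom (homOfCochain f) x = f.eval x.symbol := homOfCochain_app_of f x.symbol
    _ = D.map (𝟙 x.obj) (f x) := f.eval_ofHom x (𝟙 x.obj)
    _ = f x := ConcreteCategory.congr_hom (D.map_id x.obj) (f x)

theorem homOfCochain_cochainOfHom (φ : bar S n ⟶ D) : homOfCochain (cochainOfHom φ) = φ := by
  ext a : 2
  apply AddCommGrpCat.hom_ext
  apply FreeAbelianGroup.lift_ext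
  intro t
  obtain ⟨x, g, rfl⟩ := t.exists_ofHom_eq
  calc (homOfCochain (cochainOfHom φ)).app a (FreeAbelianGroup.of (Symbol.ofHom x g))
      _ = (cochainOfHom φ).eval (Symbol.ofHom x g) := homOfCochain_app_of _ _
      _ = D.map g (φ.app x.obj (FreeAbelianGroup.of x.symbol)) := Cochain.eval_ofHom _ x g
      _ = φ.app a (FreeAbelianGroup.of (Symbol.map g x.symbol)) := (hom_app_of_map φ g _).symm
      _ = φ.app a (FreeAbelianGroup.of (Symbol.ofHom x g)) := by rw [Nerve.map_symbol]

/-- The isomorphism `Hom(Bₙ, D) ≃ Cⁿ(S, D)`: a morphism out of `Bₙ` is determined by its values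
on the symbols `[1, a₁, …, aₙ, 1]`, which are arbitrary. -/
def homEquivCochain (D : NatSys S) (n : ℕ) : (bar S n ⟶ D) ≃+ Cochain D n where
  toFun := cochainOfHom
  invFun := homOfCochain
  left_inv := homOfCochain_cochainOfHom
  right_inv := cochainOfHom_homOfCochain
  map_add' _ _ := rfl

theorem barBoundaryAt_of {a : Fac S} (t : Symbol (n + 1) a) :
    barBoundaryAt n a (FreeAbelianGroup.of t) =
      ∑ i : Fin (n + 2), (-1 : ℤ) ^ (i : ℕ) • FreeAbelianGroup.of (t.face i) :=
  FreeAbelianGroup.lift_apply_of _ _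

theorem cochainOfHom_barBoundary_comp (φ : bar S n ⟶ D) :
    cochainOfHom (barBoundary S n ≫ φ) = coboundary D n (cochainOfHom φ) := by
  funext x
  rw [coboundary_apply]
  calc φ.app x.obj (barBoundaryAt n x.obj (FreeAbelianGroup.of x.symbol))
      _ = ∑ i : Fin (n + 2), (-1 : ℤ) ^ (i : ℕ) •
          φ.app x.obj (FreeAbelianGroup.of (x.symbol.face i)) := by
        rw [barBoundaryAt_of]
        exact (map_sum (φ.app x.obj).hom _ _).trans
          (Finset.sum_congr rfl fun i _ => map_zsmul (φ.app x.obj).hom _ _)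
      _ = ∑ i : Fin (n + 2), (-1 : ℤ) ^ (i : ℕ) •
          D.map (x.faceHom i) (cochainOfHom φ (x.face i)) := by
        refine Finset.sum_congr rfl fun i _ => congrArg _ ?_
        rw [Nerve.face_symbol]
        exact hom_app_of_map φ _ _

theorem cochainOfHom_comp (φ : bar S n ⟶ D) (ψ : D ⟶ E) :
    cochainOfHom (φ ≫ ψ) = cochainMap ψ n (cochainOfHom φ) := rfl

instance bar_projective (S : Type u) [MonoidWithZero S] (n : ℕ) : Projective (bar S n) where
  factors {E X} φ e _ := by
    have he (a : Fac S) : Function.Surjective (e.app a) :=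
      (AddCommGrpCat.epi_iff_surjective _).1 inferInstance
    choose f hf using fun x : Nerve S n => he x.obj (cochainOfHom φ x)
    refine ⟨homOfCochain f, (homEquivCochain X n).injective ?_⟩
    change cochainOfHom (homOfCochain f ≫ e) = cochainOfHom φ
    rw [cochainOfHom_comp, cochainOfHom_homOfCochain]
    exact funext hf

end HomBar

section Homotopy

variable {S : Type u} [MonoidWithZero S] {n : ℕ} {a : Fac S}

/-- The symbol `[1, a₀, …, aₙ₊₁]`, the value on `[a₀, …, aₙ₊₁]` of the contracting homotopy. -/
def Symbol.consOne (t : Symbol n a) : Symbol (n + 1) a :=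
  ⟨Fin.cons 1 t.1, by rw [tprod_succ, Fin.tail_cons, Fin.cons_zero, one_mul, t.2]⟩

theorem Symbol.face_zero_consOne (t : Symbol n a) : t.consOne.face 0 = t :=
  Subtype.ext ((contract_cons_zero 1 t.1).trans (by rw [one_mul, Fin.cons_self_tail]))

theorem Symbol.face_succ_consOne (t : Symbol (n + 1) a) (i : Fin (n + 2)) :
    t.consOne.face i.succ = (t.face i).consOne :=
  Subtype.ext (contract_cons_succ 1 t.1 i)

/-- The contracting homotopy of the augmented bar complex at the object `a`. -/
def barHomotopyAt (n : ℕ) (a : Fac S) :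
    FreeAbelianGroup (Symbol n a) →+ FreeAbelianGroup (Symbol (n + 1) a) :=
  FreeAbelianGroup.map Symbol.consOne

theorem barHomotopyAt_of (t : Symbol n a) :
    barHomotopyAt n a (FreeAbelianGroup.of t) = FreeAbelianGroup.of t.consOne :=
  FreeAbelianGroup.map_of_apply t

theorem barBoundaryAt_barHomotopyAt_succ (x : FreeAbelianGroup (Symbol (n + 1) a)) :
    barBoundaryAt (n + 1) a (barHomotopyAt (n + 1) a x) +
      barHomotopyAt n a (barBoundaryAt n a x) = x := by
  suffices h : (barBoundaryAt (n + 1) a).comp (barHomotopyAt (n + 1) a) +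
      (barHomotopyAt n a).comp (barBoundaryAt n a) = AddMonoidHom.id _ from DFunLike.congr_fun h x
  refine FreeAbelianGroup.lift_ext _ _ fun t => ?_
  change barBoundaryAt (n + 1) a (barHomotopyAt (n + 1) a (.of t)) +
      barHomotopyAt n a (barBoundaryAt n a (.of t)) = .of t
  have hcancel (i : Fin (n + 2)) :
      (-1 : ℤ) ^ (i.succ : ℕ) • FreeAbelianGroup.of (t.consOne.face i.succ) +
        barHomotopyAt n a ((-1 : ℤ) ^ (i : ℕ) • FreeAbelianGroup.of (t.face i)) = 0 := by
    rw [map_zsmul, barHomotopyAt_of, t.face_succ_consOne, Fin.val_succ, pow_succ, mul_neg_one,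
      neg_smul, neg_add_cancel]
  rw [barHomotopyAt_of, barBoundaryAt_of, barBoundaryAt_of, Fin.sum_univ_succ,
    t.face_zero_consOne, map_sum, add_assoc, ← Finset.sum_add_distrib,
    Finset.sum_eq_zero fun i _ => hcancel i, Fin.val_zero, pow_zero, one_smul, add_zero]

/-- The symbol `[1, a]`, the value on the generator of the contracting homotopy. -/
def Fac.symbol (a : Fac S) : Symbol 0 a := ⟨Fin.cons 1 fun _ => a.val, by simp [tprod]⟩

theorem Symbol.consOne_face_one (t : Symbol 0 a) : t.consOne.face 1 = a.symbol := by
  have ht : t.1 0 * t.1 1 = a.val := by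
    refine Eq.trans ?_ t.2
    simp [tprod]
  have hc : contract t.1 0 = fun _ => a.val := by
    funext k
    rw [Fin.eq_zero k]
    exact ht
  exact Subtype.ext ((contract_cons_succ 1 t.1 0).trans (congrArg (Fin.cons 1) hc))

/-- The component at `a` of the augmentation `B₀ ⟶ ℤ`. -/
def barAugmentationAt (a : Fac S) : FreeAbelianGroup (Symbol 0 a) →+ ULift.{u} ℤ :=
  FreeAbelianGroup.lift fun _ => ULift.up 1

theorem barAugmentationAt_of (t : Symbol 0 a) :
    barAugmentationAt a (FreeAbelianGroup.of t) = ULift.up 1 :=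
  FreeAbelianGroup.lift_apply_of _ _

theorem barBoundaryAt_barHomotopyAt_zero (x : FreeAbelianGroup (Symbol 0 a)) :
    barBoundaryAt 0 a (barHomotopyAt 0 a x) +
      (barAugmentationAt a x).down • FreeAbelianGroup.of a.symbol = x := by
  suffices h : (barBoundaryAt 0 a).comp (barHomotopyAt 0 a) +
      (zmultiplesHom _ (FreeAbelianGroup.of a.symbol)).comp
        (AddEquiv.ulift.toAddMonoidHom.comp (barAugmentationAt a)) =
      AddMonoidHom.id _ from DFunLike.congr_fun h x
  refine FreeAbelianGroup.lift_ext _ _ fun t => ?_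
  change barBoundaryAt 0 a (barHomotopyAt 0 a (.of t)) +
      (barAugmentationAt a (.of t)).down • .of a.symbol = .of t
  rw [barHomotopyAt_of, barBoundaryAt_of, barAugmentationAt_of, Fin.sum_univ_two,
    t.face_zero_consOne, t.consOne_face_one]
  simp

end Homotopy

section Resolution

variable (S : Type u) [MonoidWithZero S]

theorem barComplex_d (n : ℕ) : (barComplex S).d (n + 1) n = barBoundary S n :=
  ChainComplex.of_d (bar S) (barBoundary S) n

theorem barComplex_exactAt_succ (n : ℕ) : (barComplex S).ExactAt (n + 1) := by
  rw [HomologicalComplex.exactAt_iff' _ (n + 2) (n + 1) n (by simp) (by simp)]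
  refine exact_of_exact_evaluation _ fun a => (ShortComplex.ab_exact_iff _).2 fun x hx => ?_
  have hx' : barBoundaryAt n a x = 0 := by
    change ((barComplex S).d (n + 1) n).app a x = 0 at hx
    rwa [barComplex_d] at hx
  refine ⟨barHomotopyAt (n + 1) a x, ?_⟩
  change ((barComplex S).d (n + 2) (n + 1)).app a _ = x
  rw [barComplex_d]
  have hsum := barBoundaryAt_barHomotopyAt_succ x
  rwa [hx', map_zero, add_zero] at hsum

theorem barAugmentation₀_exact (w : (barComplex S).d 1 0 ≫ barAugmentation₀ S = 0) :
    (ShortComplex.mk ((barComplex S).d 1 0) (barAugmentation₀ S) w).Exact := by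
  refine exact_of_exact_evaluation _ fun a => (ShortComplex.ab_exact_iff _).2 fun x hx => ?_
  have hx' : barAugmentationAt a x = 0 := hx
  refine ⟨barHomotopyAt 0 a x, ?_⟩
  change ((barComplex S).d 1 0).app a _ = x
  rw [barComplex_d]
  have hsum := barBoundaryAt_barHomotopyAt_zero x
  rwa [hx', ULift.zero_down, zero_smul, add_zero] at hsum

theorem barAugmentation₀_epi : Epi (barAugmentation₀ S) := by
  refine (NatTrans.epi_iff_epi_app _).2 fun a =>
    (AddCommGrpCat.epi_iff_surjective _).2 fun m => ⟨m.down • FreeAbelianGroup.of a.symbol, ?_⟩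
  change barAugmentationAt a (m.down • FreeAbelianGroup.of a.symbol) = m
  rw [map_zsmul, barAugmentationAt_of]
  ext
  simp

instance barAugmentation_quasiIso : QuasiIso (barAugmentation S) :=
  quasiIso_toSingle₀Equiv_symm (barAugmentation₀_epi S) _ (barAugmentation₀_exact S _)
    (barComplex_exactAt_succ S)

/-- The bar resolution of the trivial natural system. -/
def barResolution : ProjectiveResolution (trivialSystem S) where
  complex := barComplex S
  projective := bar_projective S
  π := barAugmentation S

end Resolution

section Comparison

theorem cochainComplex_d {S : Type u} [MonoidWithZero S] (D : NatSys S) (n : ℕ) :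
    (cochainComplex D).d n (n + 1) = AddCommGrpCat.ofHom (coboundary D n) := by
  simp only [cochainComplex, CochainComplex.of_d]

theorem zeroCochainComplex_d {S : Type u} [MonoidWithZero S] (A : ZeroModule S) (n : ℕ) :
    (zeroCochainComplex A).d n (n + 1) = AddCommGrpCat.ofHom (zeroCoboundary A n) := by
  simp only [zeroCochainComplex, CochainComplex.of_d]

variable (S : Type u) [MonoidWithZero S]

/-- The isomorphism of cochain complexes `Hom(B, D) ≅ C(S, D)`, natural in `D`. -/
def homFunctorBarIso : homFunctor (barComplex S) ≅ cochainFunctor S :=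
  NatIso.ofComponents
    (fun D => HomologicalComplex.Hom.isoOfComponents
      (fun n => (homEquivCochain D n).toAddCommGrpIso) (by
        rintro n _ rfl
        ext φ
        change (cochainComplex D).d n (n + 1) (cochainOfHom φ) =
          cochainOfHom ((barComplex S).d (n + 1) n ≫ φ)
        rw [cochainComplex_d, barComplex_d]
        exact (cochainOfHom_barBoundary_comp φ).symm))
    fun ψ => by
      ext n φ
      exact cochainOfHom_comp φ ψ

/-- The isomorphism `Hⁿ(S, -) ≅ Extⁿ(ℤ, -)`. -/
def cohomologyIsoExt (n : ℕ) :
    cohomology S n ≅ extFunctorObj.{u} (trivialSystem S) n :=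
  Functor.isoWhiskerRight (homFunctorBarIso S).symm (HomologicalComplex.homologyFunctor _ _ n) ≪≫
    homologyHomFunctorIso (barResolution S) n

/-- The complex of 0-cochains of a 0-module is the cochain complex of its natural system. -/
def zeroCochainFunctorIso : zeroCochainFunctor S ≅ zeroModuleToNatSys S ⋙ cochainFunctor S :=
  NatIso.ofComponents
    (fun A => HomologicalComplex.Hom.isoOfComponents (fun _ => Iso.refl _) (by
      rintro n _ rfl
      change 𝟙 _ ≫ (cochainComplex A.toNatSys).d n (n + 1) =
        (zeroCochainComplex A).d n (n + 1) ≫ 𝟙 _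
      rw [cochainComplex_d, zeroCochainComplex_d]
      ext f : 2
      exact (zeroCoboundary_eq A n f).symm))
    fun _ => rfl

/-- The isomorphism `H₀ⁿ(S, A) ≅ Extⁿ(ℤ, 𝐀)`, natural in the 0-module `A`. -/
def zeroCohomologyIsoExt (n : ℕ) :
    zeroCohomology S n ≅ zeroModuleToNatSys S ⋙ extFunctorObj.{u} (trivialSystem S) n :=
  Functor.isoWhiskerRight (zeroCochainFunctorIso S) (HomologicalComplex.homologyFunctor _ _ n) ≪≫
    Functor.isoWhiskerLeft (zeroModuleToNatSys S) (cohomologyIsoExt S n)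

end Comparison

end FacCohomology

end

theorem theorem14 (S : Type u) [MonoidWithZero S] :
    (∀ n : ℕ, Nonempty (FacCohomology.cohomology S n ≅
      Abelian.extFunctorObj.{u} (FacCohomology.trivialSystem S) n)) ∧
    ((∀ n : ℕ, Projective (FacCohomology.bar S n)) ∧
      QuasiIso (FacCohomology.barAugmentation S)) ∧
    (∀ n : ℕ, Nonempty (FacCohomology.zeroCohomology S n ≅
      FacCohomology.zeroModuleToNatSys S ⋙
        Abelian.extFunctorObj.{u} (FacCohomology.trivialSystem S) n)) :=
  ⟨fun n => ⟨FacCohomology.cohomologyIsoExt S n⟩,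
    ⟨FacCohomology.bar_projective S, FacCohomology.barAugmentation_quasiIso S⟩,
    fun n => ⟨FacCohomology.zeroCohomologyIsoExt S n⟩⟩
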